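/- **Proposition (Fisher Information Bounds for Bi-Lipschitz Encoders).** \label{prop:fisher_bi_lip} Let $\mathcal M\subset\mathbb R^D$ be an $m$-dimensional smooth embedded submanifold (without boundary) with the Riemannian metric and Riemannian volume $\mathrm{vol}_{\mathcal M}$ induced from $\mathbb R^D$, and let $E:\mathcal M\to\mathbb R^d$ be a smooth map that is a homeomorphism onto its image $\mathcal N:=E(\mathcal M)$. For $x\in\mathcal M$ let $J_E(x):T_x\mathcal M\to\mathbb R^d$ be its tangential Jacobian. Let $P$ be a probability measure of the form $dP=p_\tau\,d\mathrm{vol}_{\mathcal M}$ with $p_\tau:\mathcal M\to(0,\infty)$ smooth (the law on $\mathcal M$ of the data at noise level $\tau$; $p_\tau$ is an arbitrary smooth positive probability density), and let $E_\#P$ be the law of $z=E(x)$ for $x\sim P$. With $\nabla_{\mathcal M}$ and $\nabla_{\mathcal N}$ denoting the Riemannian (tangential) gradients, define $$\mathcal I^{(D)}=\mathbb E_{x\sim P}\big[\|\nabla_{\mathcal M}\log p_\tau(x)\|^2\big],\qquad \mathcal I^{(d)}=\mathbb E_{z\sim E_\#P}\big[\|\nabla_{\mathcal N}\log q_\tau(z)\|^2\big]\qquad(\text{values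 in }[0,\infty]),$$ where $q_\tau$ is the smooth positive density of $E_\#P$ with respect to $\mathrm{vol}_{\mathcal N}$. 1. Suppose that there are constants $c,C>0$ with $$c\,\|v\|\le\|J_E(x)v\|\le C\,\|v\|\qquad\text{for all }x\in\mathcal M,\ v\in T_x\mathcal M,$$ and that $\nabla_{\mathcal M}\log\sqrt{\det\!\big(J_E(x)^\top J_E(x)\big)}=0$ for all $x\in\mathcal M$. Then $\mathcal N$ is an $m$-dimensional smooth embedded submanifold of $\mathbb R^d$, the density $q_\tau$ exists, and $$\frac1{C^2}\,\mathcal I^{(D)}\le\mathcal I^{(d)}\le\frac1{c^2}\,\mathcal I^{(D)}.$$ 2. If $E$ is an isometric embedding, i.e. $\|J_E(x)v\|=\|v\|$ for all $x\in\mathcal M$ and $v\in T_x\mathcal M$, then $\mathcal N$ is an $m$-dimensional smooth embedded submanifold of $\mathbb R^d$, the density $q_\tau$ exists, and $\mathcal I^{(d)}=\mathcal I^{(D)}$. -/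

import Mathlib

open Set MeasureTheory
open scoped ContDiff ENNReal

noncomputable section

/-- `M ⊆ ℝⁿ` is an `m`-dimensional smooth (embedded, boundaryless) submanifold: near each of its
points it is the image of an open subset `U` of `ℝᵐ` under a smooth map `φ` whose inverse is
smooth, i.e. is the restriction of a smooth map `ψ` defined on an open subset of `ℝⁿ`. -/
def IsSmoothSubmanifold (m : ℕ) {n : ℕ} (M : Set (EuclideanSpace ℝ (Fin n))) : Prop :=
  ∀ x ∈ M, ∃ (U : Set (EuclideanSpace ℝ (Fin m))) (V : Set (EuclideanSpace ℝ (Fin n)))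
    (φ : EuclideanSpace ℝ (Fin m) → EuclideanSpace ℝ (Fin n))
    (ψ : EuclideanSpace ℝ (Fin n) → EuclideanSpace ℝ (Fin m)),
    IsOpen U ∧ IsOpen V ∧ x ∈ V ∧ ContDiffOn ℝ ∞ φ U ∧ ContDiffOn ℝ ∞ ψ V ∧
      φ '' U = M ∩ V ∧ ∀ u ∈ U, ψ (φ u) = u

/-- The tangent space `T_x M`, as a linear subspace of `ℝⁿ`. For a submanifold the tangent cone is
already a linear subspace, so that the span adds nothing. -/
def tangentSpaceAt {n : ℕ} (M : Set (EuclideanSpace ℝ (Fin n))) (x : EuclideanSpace ℝ (Fin n)) :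
    Submodule ℝ (EuclideanSpace ℝ (Fin n)) :=
  Submodule.span ℝ (tangentConeAt ℝ M x)

/-- The tangential Jacobian `J_E(x) : T_x M → ℝᵈ`. A derivative within `M` is determined only on
tangent vectors, and it is restricted to these here. -/
def tangentialJacobian {n d : ℕ} (M : Set (EuclideanSpace ℝ (Fin n)))
    (E : EuclideanSpace ℝ (Fin n) → EuclideanSpace ℝ (Fin d)) (x : EuclideanSpace ℝ (Fin n)) :
    tangentSpaceAt M x →ₗ[ℝ] EuclideanSpace ℝ (Fin d) :=
  (fderivWithin ℝ E M x).toLinearMap.domRestrict (tangentSpaceAt M x)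

/-- The volume element `√det (J_E(x)ᵀ J_E(x))`, where the transpose is the adjoint with respect
to the Euclidean inner products on `T_x M` and `ℝᵈ`. -/
def volumeElement {n d : ℕ} (M : Set (EuclideanSpace ℝ (Fin n)))
    (E : EuclideanSpace ℝ (Fin n) → EuclideanSpace ℝ (Fin d)) (x : EuclideanSpace ℝ (Fin n)) :
    ℝ :=
  √(LinearMap.det (LinearMap.adjoint (tangentialJacobian M E x) ∘ₗ tangentialJacobian M E x))

/-- The manifold gradient `∇_M f (x) ∈ T_x M`: the orthogonal projection to `T_x M` of the vector
representing a derivative of `f` within `M` (it does not depend on the choice of the latter). -/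
def manifoldGradient {n : ℕ} (M : Set (EuclideanSpace ℝ (Fin n)))
    (f : EuclideanSpace ℝ (Fin n) → ℝ) (x : EuclideanSpace ℝ (Fin n)) :
    EuclideanSpace ℝ (Fin n) :=
  (tangentSpaceAt M x).starProjection (gradientWithin f M x)

/-- The Riemannian volume measure of an `m`-dimensional submanifold `M ⊆ ℝⁿ`: the
`m`-dimensional Hausdorff measure on `M`, normalized so as to agree with Lebesgue measure
on `ℝᵐ`. -/
def riemannianVolume (m : ℕ) {n : ℕ} (M : Set (EuclideanSpace ℝ (Fin n))) :
    Measure (EuclideanSpace ℝ (Fin n)) :=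
  (Measure.euclideanHausdorffMeasure m).restrict M

/-- `p` is a smooth strictly positive density on `M` of the measure `P` with respect to the
Riemannian volume of `M`; in particular `P` is concentrated on `M`. -/
structure IsSmoothPosDensity (m : ℕ) {n : ℕ} (M : Set (EuclideanSpace ℝ (Fin n)))
    (P : Measure (EuclideanSpace ℝ (Fin n))) (p : EuclideanSpace ℝ (Fin n) → ℝ) : Prop where
  smooth : ContDiffOn ℝ ∞ p M
  pos : ∀ x ∈ M, 0 < p x
  eq_withDensity : P = (riemannianVolume m M).withDensity (fun x => ENNReal.ofReal (p x))

/-- The manifold Fisher information `𝔼_P ‖∇_M log p‖²` of the law `P` with density `p` on `M`,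
with values in `[0, ∞]`. -/
def manifoldFisherInformation {n : ℕ} (M : Set (EuclideanSpace ℝ (Fin n)))
    (P : Measure (EuclideanSpace ℝ (Fin n))) (p : EuclideanSpace ℝ (Fin n) → ℝ) : ℝ≥0∞ :=
  ∫⁻ x, ‖manifoldGradient M (fun y => Real.log (p y)) x‖ₑ ^ 2 ∂P

end

open scoped NNReal Topology
open Filter Module

/-! By change of variables, the push-forward has density `q (E x) = p x / volumeElement M E x`. So
`log q ∘ E` and `log p` differ by the logarithm of the volume element, whose tangential gradient
vanishes, and the two functions have the same differential on each tangent space. The Jacobian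
changes lengths by a factor between `c` and `C`; evaluating the common differential on the vector
that represents it bounds `‖∇ log p‖` by `C` times `‖∇ log q‖` at the image point, and the latter by
`1 / c` times the former. Squaring and integrating against `P` gives the bounds. An isometry has
volume element `1`, and `c = C = 1` forces equality.

The main work is the change of variables, because Riemannian volume is a Hausdorff measure here. It
rests on the area formula `euclideanHausdorffMeasure_image_eq_lintegral`: near a point, an immersion
is `K`-close to its orthogonal projection to the tangent space, where the Lebesgue formula applies,
and `K` tends to `1`. `IsLocalParametrization.exists_comp` provides parametrizations `φ` of `M` and
`E ∘ φ` of `E '' M` on a common domain, whose area densities are related by multiplicativity of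
`normDet`. `IsSmoothPosDensity.eqOn` transfers the formula to any smooth density `q`. -/

theorem euclideanHausdorffMeasure_image_le_of_dist_le {α X Y : Type*}
    [MetricSpace X] [MeasurableSpace X] [BorelSpace X]
    [MetricSpace Y] [MeasurableSpace Y] [BorelSpace Y]
    {f : α → X} {g : α → Y} {s : Set α} {K : ℝ≥0} (m : ℕ)
    (h : ∀ x ∈ s, ∀ y ∈ s, dist (f x) (f y) ≤ K * dist (g x) (g y)) :
    μHE[m] (f '' s) ≤ (K : ℝ≥0∞) ^ m * μHE[m] (g '' s) := by
  rcases s.eq_empty_or_nonempty with rfl | ⟨a, ha⟩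
  · simp
  have : Nonempty α := ⟨a⟩
  -- `g` may fail to be injective, but points of `s` with equal `g` have equal `f`, so `f` factors
  -- through `g` by a `K`-Lipschitz map.
  have hr : ∀ x ∈ s, f (Function.invFunOn g s (g x)) = f x := by
    intro x hx
    have hm : g x ∈ g '' s := mem_image_of_mem g hx
    have := h _ (Function.invFunOn_mem hm) x hx
    rw [Function.invFunOn_eq hm, dist_self, mul_zero] at this
    exact dist_le_zero.1 this
  have himg : f '' s = (f ∘ Function.invFunOn g s) '' (g '' s) := by
    rw [image_image]
    exact image_congr fun x hx => (hr x hx).symm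
  have hL : LipschitzOnWith K (f ∘ Function.invFunOn g s) (g '' s) := by
    refine LipschitzOnWith.of_dist_le_mul ?_
    rintro _ ⟨x, hx, rfl⟩ _ ⟨y, hy, rfl⟩
    simp only [Function.comp_apply, hr x hx, hr y hy]
    exact h x hx y hy
  have := hL.hausdorffMeasure_image_le (d := m) (Nat.cast_nonneg m)
  rw [himg]
  simp only [Measure.euclideanHausdorffMeasure_def, Measure.smul_apply,
    Measure.nnreal_smul_coe_apply]
  rw [mul_left_comm]
  gcongr
  simpa using this

/-- A measurable set is a countable disjoint union of measurable sets subordinate to a given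
family of neighbourhoods of its points. -/
theorem exists_measurable_partition_subordinate {X : Type*} [TopologicalSpace X]
    [SecondCountableTopology X] [MeasurableSpace X] [OpensMeasurableSpace X]
    {A : Set X} (hA : MeasurableSet A) {W : X → Set X} (hW : ∀ x ∈ A, IsOpen (W x) ∧ x ∈ W x) :
    ∃ B : ℕ → Set X, (∀ i, MeasurableSet (B i)) ∧ Pairwise (Function.onFun Disjoint B) ∧
      ⋃ i, B i = A ∧ ∀ i, B i = ∅ ∨ ∃ x ∈ A, B i ⊆ W x := by
  rcases A.eq_empty_or_nonempty with rfl | hne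
  · exact ⟨fun _ => ∅, by simp, fun _ _ _ => by simp [Function.onFun], by simp, by simp⟩
  obtain ⟨t, htA, htc, hcov⟩ := TopologicalSpace.countable_cover_nhdsWithin
    (f := W) (s := A) fun x hx => mem_nhdsWithin_of_mem_nhds ((hW x hx).1.mem_nhds (hW x hx).2)
  have htne : t.Nonempty := by
    by_contra h
    rw [not_nonempty_iff_eq_empty] at h
    subst h
    simp at hcov
    exact hne.ne_empty hcov
  obtain ⟨f, rfl⟩ := htc.exists_eq_range htne
  have hfA : ∀ i, f i ∈ A := fun i => htA (mem_range_self i)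
  refine ⟨fun i => A ∩ disjointed (fun j => W (f j)) i, fun i => hA.inter ?_, ?_, ?_, ?_⟩
  · exact MeasurableSet.disjointed (fun j => (hW _ (hfA j)).1.measurableSet) i
  · intro i j hij
    exact (disjoint_disjointed _ hij).mono inter_subset_right inter_subset_right
  · rw [← inter_iUnion, iUnion_disjointed, inter_eq_left]
    simpa using hcov
  · exact fun i => Or.inr ⟨f i, hfA i, inter_subset_right.trans (disjointed_subset _ _)⟩

theorem LinearMap.normDet_pos_of_injective {X Y : Type*} [NormedAddCommGroup X]
    [InnerProductSpace ℝ X] [FiniteDimensional ℝ X] [NormedAddCommGroup Y] [InnerProductSpace ℝ Y]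
    {f : X →ₗ[ℝ] Y} (hf : Function.Injective f) : 0 < f.normDet := by
  have h : f.normDet ≠ 0 := (f.normDet_ne_zero_tfae.out 0 4).2 hf
  exact lt_of_le_of_ne f.normDet_nonneg h.symm

/-! ### The area formula for smooth injective immersions -/

section Area

variable {m : ℕ} {F : Type*} [NormedAddCommGroup F] [InnerProductSpace ℝ F]
  [FiniteDimensional ℝ F]

theorem continuousAt_normDet_fderiv {φ : EuclideanSpace ℝ (Fin m) → F}
    {u : EuclideanSpace ℝ (Fin m)} (h : ContinuousAt (fderiv ℝ φ) u) :
    ContinuousAt (fun v => (fderiv ℝ φ v).toLinearMap.normDet) u := by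
  have h1 : ∀ v, (fderiv ℝ φ v).toLinearMap.normDet =
      √((fderiv ℝ φ v).adjoint ∘L (fderiv ℝ φ v)).det := fun v => by
    have := (fderiv ℝ φ v).normDet_sq
    simp only [RCLike.ofReal_real_eq_id, id] at this
    rw [← this, Real.sqrt_sq (LinearMap.normDet_nonneg _)]
  simp only [h1]
  have h2 : ContinuousAt (fun v => (fderiv ℝ φ v).adjoint) u :=
    ContinuousLinearMap.adjoint.continuous.continuousAt.comp h
  exact Real.continuous_sqrt.continuousAt.comp
    (ContinuousLinearMap.continuous_det.continuousAt.comp (h2.clm_comp h))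

/-- Near a point with injective derivative, a map is `K`-close to its orthogonal projection to the
tangent space, in a bi-Lipschitz sense and in the sense of volume elements. -/
theorem exists_projection_dist_le {U : Set (EuclideanSpace ℝ (Fin m))}
    (hU : IsOpen U) {φ : EuclideanSpace ℝ (Fin m) → F} (hφ : ContDiffOn ℝ ∞ φ U)
    {u : EuclideanSpace ℝ (Fin m)} (hu : u ∈ U) (hinj : Function.Injective (fderiv ℝ φ u))
    {K : ℝ≥0} (hK : 1 < K) :
    ∃ (π : F →L[ℝ] EuclideanSpace ℝ (Fin m)) (W : Set (EuclideanSpace ℝ (Fin m))),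
      IsOpen W ∧ u ∈ W ∧ W ⊆ U ∧ (∀ y, ‖π y‖ ≤ ‖y‖) ∧
      (∀ x ∈ W, ∀ y ∈ W, dist (φ x) (φ y) ≤ K * dist (π (φ x)) (π (φ y))) ∧
      ∀ x ∈ W, |(π ∘L fderiv ℝ φ x).det| ≤ K * (fderiv ℝ φ x).toLinearMap.normDet ∧
        (fderiv ℝ φ x).toLinearMap.normDet ≤ K * |(π ∘L fderiv ℝ φ x).det| := by
  set A := fderiv ℝ φ u with hA
  have hdiff : ContDiffAt ℝ ∞ φ u := hφ.contDiffAt (hU.mem_nhds hu)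
  have hrank : finrank ℝ A.toLinearMap.range = m := by
    simpa using LinearMap.finrank_range_of_inj (f := A.toLinearMap) hinj
  -- `π` is the orthogonal projection to the range of `A`, read in orthonormal coordinates: a
  -- contraction that is isometric on that range.
  let e : A.toLinearMap.range ≃ₗᵢ[ℝ] EuclideanSpace ℝ (Fin m) :=
    ((stdOrthonormalBasis ℝ A.toLinearMap.range).reindex (finCongr hrank)).repr
  let π : F →L[ℝ] EuclideanSpace ℝ (Fin m) :=
    e.toContinuousLinearEquiv.toContinuousLinearMap ∘L A.toLinearMap.range.orthogonalProjectionOnto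
  have hπle : ∀ y, ‖π y‖ ≤ ‖y‖ := fun y => by
    simp only [π, ContinuousLinearMap.comp_apply]
    have : ‖e (A.toLinearMap.range.orthogonalProjectionOnto y)‖ ≤ ‖y‖ := by
      rw [e.norm_map]
      exact Submodule.norm_orthogonalProjectionOnto_apply_le _ _
    exact this
  have hπA : ∀ w, ‖π (A w)‖ = ‖A w‖ := fun w => by
    have h1 : A.toLinearMap.range.orthogonalProjectionOnto (A w) =
        ⟨A w, LinearMap.mem_range_self A.toLinearMap w⟩ :=
      Submodule.orthogonalProjectionOnto_mem_subspace_eq_self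
        (K := A.toLinearMap.range) ⟨A w, LinearMap.mem_range_self A.toLinearMap w⟩
    have : ‖e (A.toLinearMap.range.orthogonalProjectionOnto (A w))‖ = ‖A w‖ := by
      rw [e.norm_map, h1]
      rfl
    exact this
  have hdet : |(π ∘L A).det| = A.toLinearMap.normDet := by
    let ι : A.toLinearMap.range →ₗᵢ[ℝ] EuclideanSpace ℝ (Fin m) :=
      ⟨π.toLinearMap.domRestrict A.toLinearMap.range, by
        rintro ⟨_, w, rfl⟩
        exact hπA w⟩
    have h1 : (π.toLinearMap.domRestrict A.toLinearMap.range).normDet = 1 := ι.normDet_eq_one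
    have h2 := LinearMap.normDet_comp A.toLinearMap π.toLinearMap
    rw [h1, one_mul, LinearMap.normDet_eq_abs_det] at h2
    exact h2
  have hpos : 0 < A.toLinearMap.normDet :=
    LinearMap.normDet_pos_of_injective hinj
  have hK' : (1 : ℝ) < K := by exact_mod_cast hK
  have hcf : ContinuousAt (fderiv ℝ φ) u :=
    (hdiff.fderiv_right (m := 0) (by simp)).continuousAt
  have hc1 : ContinuousAt (fun v => (fderiv ℝ φ v).toLinearMap.normDet) u :=
    continuousAt_normDet_fderiv hcf
  have hc2 : ContinuousAt (fun v => |(π ∘L fderiv ℝ φ v).det|) u :=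
    continuous_abs.continuousAt.comp (ContinuousLinearMap.continuous_det.continuousAt.comp
      (continuousAt_const.clm_comp hcf))
  -- At `u` both determinants equal the same positive number, so `1 < K` makes the inequalities
  -- strict there and they persist nearby.
  have ev1 : ∀ᶠ v in 𝓝 u, |(π ∘L fderiv ℝ φ v).det| < K * (fderiv ℝ φ v).toLinearMap.normDet :=
    hc2.eventually_lt (continuousAt_const.mul hc1) (by
      show |(π ∘L A).det| < K * A.toLinearMap.normDet
      rw [hdet]; nlinarith)
  have ev2 : ∀ᶠ v in 𝓝 u, (fderiv ℝ φ v).toLinearMap.normDet < K * |(π ∘L fderiv ℝ φ v).det| :=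
    hc1.eventually_lt (continuousAt_const.mul hc2) (by
      show A.toLinearMap.normDet < K * |(π ∘L A).det|
      rw [hdet]; nlinarith)
  obtain ⟨a, ha, hanti⟩ := A.toLinearMap.exists_antilipschitzWith (LinearMap.ker_eq_bot.2 hinj)
  have hbd : ∀ w, ‖w‖ ≤ a * ‖A w‖ := fun w => by
    simpa using hanti.le_mul_dist w 0
  -- choose the error `ε` of linear approximation
  have haR : (0 : ℝ) < a := by exact_mod_cast ha
  -- Chosen so that the error is at most `q * ‖A (x - y)‖` with `q = (K - 1) / (K + 1)`, the
  -- solution of `1 + q = K * (1 - q)`.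
  let ε : ℝ := (K - 1) / (a * (K + 1))
  have hε : 0 < ε := by
    have : (0 : ℝ) < K - 1 := by linarith
    positivity
  obtain ⟨s, hs, happ⟩ := (hdiff.hasStrictFDerivAt (by simp)).approximates_deriv_on_nhds
    (c := ⟨ε, hε.le⟩) (Or.inr hε)
  obtain ⟨W, hWsub, hWo, huW⟩ := mem_nhds_iff.1
    (inter_mem (inter_mem hs (hU.mem_nhds hu)) (ev1.and ev2))
  refine ⟨π, W, hWo, huW, fun x hx => (hWsub hx).1.2, hπle, fun x hx y hy => ?_,
    fun x hx => ⟨(hWsub hx).2.1.le, (hWsub hx).2.2.le⟩⟩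
  have h1 : ‖φ x - φ y - A (x - y)‖ ≤ ε * ‖x - y‖ := happ x (hWsub hx).1.1 y (hWsub hy).1.1
  have h2 : ‖φ x - φ y‖ ≤ ‖A (x - y)‖ + ε * ‖x - y‖ := by
    have := norm_add_le (φ x - φ y - A (x - y)) (A (x - y))
    rw [sub_add_cancel] at this
    linarith
  have h3 : ‖A (x - y)‖ ≤ ‖π (φ x) - π (φ y)‖ + ε * ‖x - y‖ := by
    rw [← hπA]
    have h4 := norm_sub_le (π (φ x) - π (φ y)) (π (φ x - φ y - A (x - y)))
    have h5 := hπle (φ x - φ y - A (x - y))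
    have h6 : π (φ x) - π (φ y) - π (φ x - φ y - A (x - y)) = π (A (x - y)) := by
      simp only [map_sub]; abel
    rw [h6] at h4
    linarith
  have h7 : ε * ‖x - y‖ ≤ (K - 1) / (K + 1) * ‖A (x - y)‖ := by
    calc ε * ‖x - y‖ ≤ ε * (a * ‖A (x - y)‖) := by gcongr; exact hbd _
      _ = (K - 1) / (K + 1) * ‖A (x - y)‖ := by
        simp only [ε]; field_simp
  rw [dist_eq_norm, dist_eq_norm]
  have hq : (K - 1 : ℝ) / (K + 1) * (K + 1) = K - 1 := by field_simp
  set q : ℝ := (K - 1 : ℝ) / (K + 1)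
  set α := ‖A (x - y)‖
  have hα : 0 ≤ α := norm_nonneg _
  have h8 : ‖φ x - φ y‖ ≤ (1 + q) * α := by linarith
  have h9 : (1 - q) * α ≤ ‖π (φ x) - π (φ y)‖ := by linarith
  have h10 : (1 + q) = K * (1 - q) := by linarith
  calc ‖φ x - φ y‖ ≤ K * ((1 - q) * α) := by rw [← mul_assoc, ← h10]; exact h8
    _ ≤ _ := by gcongr

variable [MeasurableSpace F] [BorelSpace F]

/-- Both halves of the area formula, up to a factor tending to `1` with `K`, on small sets. -/
theorem exists_open_area_estimate {U : Set (EuclideanSpace ℝ (Fin m))}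
    (hU : IsOpen U) {φ : EuclideanSpace ℝ (Fin m) → F} (hφ : ContDiffOn ℝ ∞ φ U)
    (hinjφ : InjOn φ U)
    {u : EuclideanSpace ℝ (Fin m)} (hu : u ∈ U) (hinj : Function.Injective (fderiv ℝ φ u))
    {K : ℝ≥0} (hK : 1 < K) :
    ∃ W : Set (EuclideanSpace ℝ (Fin m)), IsOpen W ∧ u ∈ W ∧ W ⊆ U ∧
      ∀ A ⊆ W, MeasurableSet A →
        μHE[m] (φ '' A) ≤ (K : ℝ≥0∞) ^ (m + 1) *
            ∫⁻ x in A, ENNReal.ofReal (fderiv ℝ φ x).toLinearMap.normDet ∧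
        ∫⁻ x in A, ENNReal.ofReal (fderiv ℝ φ x).toLinearMap.normDet ≤
            (K : ℝ≥0∞) ^ (m + 1) * μHE[m] (φ '' A) := by
  obtain ⟨π, W, hWo, huW, hWU, hπ, hd, hJ⟩ := exists_projection_dist_le hU hφ hu hinj hK
  refine ⟨W, hWo, huW, hWU, fun A hAW hA => ?_⟩
  have hder : ∀ x ∈ A, HasFDerivWithinAt (fun v => π (φ v)) (π ∘L fderiv ℝ φ x) A x := by
    intro x hx
    have hxU := hWU (hAW hx)
    have := ((hφ.contDiffAt (hU.mem_nhds hxU)).differentiableAt (by simp)).hasFDerivAt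
    exact (π.hasFDerivAt.comp x this).hasFDerivWithinAt
  have hinjh : InjOn (fun v => π (φ v)) A := by
    intro x hx y hy hxy
    have := hd x (hAW hx) y (hAW hy)
    rw [show π (φ x) = π (φ y) from hxy, dist_self, mul_zero] at this
    exact hinjφ (hWU (hAW hx)) (hWU (hAW hy)) (dist_le_zero.1 this)
  have hvol := lintegral_abs_det_fderiv_eq_addHaar_image volume hA hder hinjh
  replace hvol := hvol.trans (b := volume ((fun v => π (φ v)) '' A))
    (c := μHE[m] ((fun v => π (φ v)) '' A)) (by
      rw [EuclideanSpace.euclideanHausdorffMeasure_eq_volume])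
  have hK0 : (1 : ℝ≥0∞) ≤ K := by exact_mod_cast hK.le
  constructor
  -- The exponent `m + 1` collects `m` factors from the Lipschitz bound and one from comparing the
  -- determinants.
  · calc μHE[m] (φ '' A)
        ≤ (K : ℝ≥0∞) ^ m * μHE[m] ((fun v => π (φ v)) '' A) :=
          euclideanHausdorffMeasure_image_le_of_dist_le m
            fun x hx y hy => hd x (hAW hx) y (hAW hy)
      _ = (K : ℝ≥0∞) ^ m * ∫⁻ x in A, ENNReal.ofReal |(π ∘L fderiv ℝ φ x).det| := by
          rw [hvol]
      _ ≤ (K : ℝ≥0∞) ^ m * ∫⁻ x in A, K *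
            ENNReal.ofReal (fderiv ℝ φ x).toLinearMap.normDet := by
          refine mul_le_mul_right ?_ _
          refine setLIntegral_mono' hA fun x hx => ?_
          rw [← ENNReal.ofReal_coe_nnreal, ← ENNReal.ofReal_mul K.coe_nonneg]
          exact ENNReal.ofReal_le_ofReal (hJ x (hAW hx)).1
      _ = _ := by
          rw [lintegral_const_mul' _ _ ENNReal.coe_ne_top, pow_succ, mul_assoc]
  · calc ∫⁻ x in A, ENNReal.ofReal (fderiv ℝ φ x).toLinearMap.normDet
        ≤ ∫⁻ x in A, K * ENNReal.ofReal |(π ∘L fderiv ℝ φ x).det| := by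
          refine setLIntegral_mono' hA fun x hx => ?_
          rw [← ENNReal.ofReal_coe_nnreal, ← ENNReal.ofReal_mul K.coe_nonneg]
          exact ENNReal.ofReal_le_ofReal (hJ x (hAW hx)).2
      _ = K * μHE[m] ((fun v => π (φ v)) '' A) := by
          rw [lintegral_const_mul' _ _ ENNReal.coe_ne_top, hvol]
      _ ≤ K * (((1 : ℝ≥0) : ℝ≥0∞) ^ m * μHE[m] (φ '' A)) := by
          gcongr
          refine euclideanHausdorffMeasure_image_le_of_dist_le m fun x _ y _ => ?_
          rw [dist_eq_norm, dist_eq_norm, ← map_sub]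
          simpa using hπ (φ x - φ y)
      _ ≤ _ := by
          rw [ENNReal.coe_one, one_pow, one_mul]
          gcongr
          exact le_self_pow₀ hK0 (by simp)

/-- The bound tends to `b` as `K` decreases to `1`, also when `b = ∞`, because the limit of the
first factor is nonzero. -/
theorem ENNReal.le_of_forall_one_lt_pow_mul {a b : ℝ≥0∞} (k : ℕ)
    (h : ∀ K : ℝ≥0, 1 < K → a ≤ (K : ℝ≥0∞) ^ k * b) : a ≤ b := by
  have ht : Tendsto (fun K : ℝ≥0 => (K : ℝ≥0∞) ^ k * b) (𝓝[>] 1) (𝓝 (1 * b)) := by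
    refine ENNReal.Tendsto.mul_const ?_ (Or.inl one_ne_zero)
    have h1 : Tendsto (fun K : ℝ≥0 => ((K ^ k : ℝ≥0) : ℝ≥0∞)) (𝓝 1) (𝓝 (((1 : ℝ≥0) ^ k : ℝ≥0))) :=
      ENNReal.tendsto_coe.2 ((continuous_pow k).tendsto 1)
    simpa using h1.mono_left nhdsWithin_le_nhds
  rw [one_mul] at ht
  exact ge_of_tendsto ht (eventually_mem_nhdsWithin.mono fun K hK => h K hK)

/-- The area formula for a smooth injective immersion. -/
theorem euclideanHausdorffMeasure_image_eq_lintegral {U : Set (EuclideanSpace ℝ (Fin m))}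
    (hU : IsOpen U) {φ : EuclideanSpace ℝ (Fin m) → F} (hφ : ContDiffOn ℝ ∞ φ U)
    (hinjφ : InjOn φ U) (hinj : ∀ u ∈ U, Function.Injective (fderiv ℝ φ u))
    {A : Set (EuclideanSpace ℝ (Fin m))} (hA : MeasurableSet A) (hAU : A ⊆ U) :
    μHE[m] (φ '' A) = ∫⁻ x in A, ENNReal.ofReal (fderiv ℝ φ x).toLinearMap.normDet := by
  have key : ∀ K : ℝ≥0, 1 < K →
      μHE[m] (φ '' A) ≤ (K : ℝ≥0∞) ^ (m + 1) *
          ∫⁻ x in A, ENNReal.ofReal (fderiv ℝ φ x).toLinearMap.normDet ∧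
      ∫⁻ x in A, ENNReal.ofReal (fderiv ℝ φ x).toLinearMap.normDet ≤
          (K : ℝ≥0∞) ^ (m + 1) * μHE[m] (φ '' A) := by
    intro K hK
    choose! W hWo hW hWU hWA using fun u (hu : u ∈ A) =>
      exists_open_area_estimate hU hφ hinjφ (hAU hu) (hinj u (hAU hu)) hK
    obtain ⟨B, hBm, hBd, hBA, hBW⟩ := exists_measurable_partition_subordinate hA
      (W := W) fun x hx => ⟨hWo x hx, hW x hx⟩
    have hBsub : ∀ i, B i ⊆ U := fun i => (subset_iUnion B i).trans (hBA.le.trans hAU)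
    -- The images are disjoint by injectivity, and Borel as injective continuous images of Borel
    -- sets (Lusin–Souslin).
    have e1 : μHE[m] (φ '' A) = ∑' i, μHE[m] (φ '' B i) := by
      rw [← hBA, image_iUnion, measure_iUnion]
      · intro i j hij
        exact disjoint_image_image fun x hx y hy hxy =>
          (hBd hij).ne_of_mem hx hy (hinjφ (hBsub i hx) (hBsub j hy) hxy)
      · exact fun i => (hBm i).image_of_continuousOn_injOn
          (hφ.continuousOn.mono (hBsub i)) (hinjφ.mono (hBsub i))
    have e2 : ∫⁻ x in A, ENNReal.ofReal (fderiv ℝ φ x).toLinearMap.normDet =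
        ∑' i, ∫⁻ x in B i, ENNReal.ofReal (fderiv ℝ φ x).toLinearMap.normDet := by
      rw [← hBA, lintegral_iUnion hBm hBd]
    have hB : ∀ i, μHE[m] (φ '' B i) ≤ (K : ℝ≥0∞) ^ (m + 1) *
          ∫⁻ x in B i, ENNReal.ofReal (fderiv ℝ φ x).toLinearMap.normDet ∧
        ∫⁻ x in B i, ENNReal.ofReal (fderiv ℝ φ x).toLinearMap.normDet ≤
          (K : ℝ≥0∞) ^ (m + 1) * μHE[m] (φ '' B i) := by
      intro i
      rcases hBW i with h | ⟨x, hx, hsub⟩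
      · simp [h]
      · exact hWA x hx (B i) hsub (hBm i)
    rw [e1, e2, ← ENNReal.tsum_mul_left, ← ENNReal.tsum_mul_left]
    exact ⟨ENNReal.tsum_le_tsum fun i => (hB i).1, ENNReal.tsum_le_tsum fun i => (hB i).2⟩
  exact le_antisymm (ENNReal.le_of_forall_one_lt_pow_mul _ fun K hK => (key K hK).1)
    (ENNReal.le_of_forall_one_lt_pow_mul _ fun K hK => (key K hK).2)

end Area

/-! ### Local parametrizations: tangent spaces, gradients, integration -/

/-- `φ : U → M ∩ V` is a local parametrization of `M`, with inverse the restriction of `ψ`. -/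
structure IsLocalParametrization {m n : ℕ} (M : Set (EuclideanSpace ℝ (Fin n)))
    (U : Set (EuclideanSpace ℝ (Fin m))) (V : Set (EuclideanSpace ℝ (Fin n)))
    (φ : EuclideanSpace ℝ (Fin m) → EuclideanSpace ℝ (Fin n))
    (ψ : EuclideanSpace ℝ (Fin n) → EuclideanSpace ℝ (Fin m)) : Prop where
  isOpen_source : IsOpen U
  isOpen_target : IsOpen V
  contDiffOn : ContDiffOn ℝ ∞ φ U
  contDiffOn_inv : ContDiffOn ℝ ∞ ψ V
  image_eq : φ '' U = M ∩ V
  left_inv : ∀ u ∈ U, ψ (φ u) = u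

theorem IsSmoothSubmanifold.exists_isLocalParametrization {m n : ℕ}
    {M : Set (EuclideanSpace ℝ (Fin n))} (hM : IsSmoothSubmanifold m M)
    {x : EuclideanSpace ℝ (Fin n)} (hx : x ∈ M) :
    ∃ U V φ ψ, IsLocalParametrization (m := m) M U V φ ψ ∧ ∃ u ∈ U, φ u = x := by
  obtain ⟨U, V, φ, ψ, h1, h2, h3, h4, h5, h6, h7⟩ := hM x hx
  have : x ∈ φ '' U := h6 ▸ ⟨hx, h3⟩
  exact ⟨U, V, φ, ψ, ⟨h1, h2, h4, h5, h6, h7⟩, this⟩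

namespace IsLocalParametrization

variable {m n : ℕ} {M : Set (EuclideanSpace ℝ (Fin n))}
    {U : Set (EuclideanSpace ℝ (Fin m))} {V : Set (EuclideanSpace ℝ (Fin n))}
    {φ : EuclideanSpace ℝ (Fin m) → EuclideanSpace ℝ (Fin n)}
    {ψ : EuclideanSpace ℝ (Fin n) → EuclideanSpace ℝ (Fin m)}

theorem mem (h : IsLocalParametrization M U V φ ψ) {u} (hu : u ∈ U) : φ u ∈ M ∩ V :=
  h.image_eq ▸ mem_image_of_mem φ hu

theorem mapsTo (h : IsLocalParametrization M U V φ ψ) : MapsTo φ U M := fun _ hu => (h.mem hu).1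

theorem injOn (h : IsLocalParametrization M U V φ ψ) : InjOn φ U :=
  (show LeftInvOn ψ φ U from h.left_inv).injOn

theorem mapsTo_inv (h : IsLocalParametrization M U V φ ψ) : MapsTo ψ (M ∩ V) U := by
  rw [← h.image_eq]
  rintro _ ⟨u, hu, rfl⟩
  rwa [h.left_inv u hu]

theorem right_inv (h : IsLocalParametrization M U V φ ψ) {y} (hy : y ∈ M ∩ V) : φ (ψ y) = y := by
  rw [← h.image_eq] at hy
  obtain ⟨u, hu, rfl⟩ := hy
  rw [h.left_inv u hu]

theorem hasFDerivAt (h : IsLocalParametrization M U V φ ψ) {u} (hu : u ∈ U) :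
    HasFDerivAt φ (fderiv ℝ φ u) u :=
  ((h.contDiffOn.contDiffAt (h.isOpen_source.mem_nhds hu)).differentiableAt (by simp)).hasFDerivAt

theorem hasFDerivAt_inv (h : IsLocalParametrization M U V φ ψ) {y} (hy : y ∈ V) :
    HasFDerivAt ψ (fderiv ℝ ψ y) y :=
  ((h.contDiffOn_inv.contDiffAt (h.isOpen_target.mem_nhds hy)).differentiableAt
    (by simp)).hasFDerivAt

theorem fderiv_inv_fderiv (h : IsLocalParametrization M U V φ ψ) {u} (hu : u ∈ U)
    (w : EuclideanSpace ℝ (Fin m)) : fderiv ℝ ψ (φ u) (fderiv ℝ φ u w) = w := by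
  have h1 := (h.hasFDerivAt_inv (h.mem hu).2).comp u (h.hasFDerivAt hu)
  have h2 : HasFDerivAt (ψ ∘ φ) (ContinuousLinearMap.id ℝ _) u :=
    (hasFDerivAt_id u).congr_of_eventuallyEq
      (mem_of_superset (h.isOpen_source.mem_nhds hu) fun v hv => h.left_inv v hv)
  exact DFunLike.congr_fun (h1.unique h2) w

theorem injective_fderiv (h : IsLocalParametrization M U V φ ψ) {u} (hu : u ∈ U) :
    Function.Injective (fderiv ℝ φ u) :=
  Function.LeftInverse.injective (g := fderiv ℝ ψ (φ u)) (h.fderiv_inv_fderiv hu)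

/-- Within `M ∩ V` the map `φ ∘ ψ` is the identity, and two derivatives within a set agree on its
tangent cone; so each vector of the cone lies in the range. Conversely, the derivative of `φ` maps
the tangent cone of the open set `U`, which is everything, into that of `M`. -/
theorem tangentSpaceAt_eq_range (h : IsLocalParametrization M U V φ ψ) {u} (hu : u ∈ U) :
    tangentSpaceAt M (φ u) = (fderiv ℝ φ u).toLinearMap.range := by
  have hV : V ∈ 𝓝 (φ u) := h.isOpen_target.mem_nhds (h.mem hu).2
  refine le_antisymm (Submodule.span_le.2 fun v hv => ?_) ?_
  · rw [← tangentConeAt_inter_nhds hV] at hv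
    have h1 : HasFDerivWithinAt (φ ∘ ψ)
        (fderiv ℝ φ u ∘L fderiv ℝ ψ (φ u)) (M ∩ V) (φ u) := by
      refine HasFDerivAt.hasFDerivWithinAt ?_
      refine HasFDerivAt.comp (φ u) ?_ (h.hasFDerivAt_inv (h.mem hu).2)
      rw [h.left_inv u hu]
      exact h.hasFDerivAt hu
    have h2 : HasFDerivWithinAt (φ ∘ ψ) (ContinuousLinearMap.id ℝ _) (M ∩ V) (φ u) :=
      (hasFDerivWithinAt_id _ _).congr (fun y hy => h.right_inv hy) (h.right_inv (h.mem hu))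
    exact ⟨fderiv ℝ ψ (φ u) v, h1.unique_on h2 hv⟩
  · rintro _ ⟨w, rfl⟩
    have h1 := (h.hasFDerivAt hu).hasFDerivWithinAt (s := U)
    have h2 : w ∈ tangentConeAt ℝ U u := by
      rw [tangentConeAt_of_mem_nhds (h.isOpen_source.mem_nhds hu)]
      exact mem_univ w
    have h3 := h1.mapsTo_tangent_cone h2
    exact Submodule.subset_span (tangentConeAt_mono h.mapsTo.image_subset h3)

theorem fderiv_mem_tangentSpaceAt (h : IsLocalParametrization M U V φ ψ) {u} (hu : u ∈ U)
    (w : EuclideanSpace ℝ (Fin m)) : fderiv ℝ φ u w ∈ tangentSpaceAt M (φ u) := by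
  rw [h.tangentSpaceAt_eq_range hu]
  exact LinearMap.mem_range_self _ w

/-- A derivative within `M` is not unique, but after composition with that of `φ` it is a full
derivative, since `U` is open. -/
theorem hasFDerivAt_comp {F : Type*} [NormedAddCommGroup F] [NormedSpace ℝ F]
    (h : IsLocalParametrization M U V φ ψ) {u} (hu : u ∈ U)
    {f : EuclideanSpace ℝ (Fin n) → F} (hf : DifferentiableWithinAt ℝ f M (φ u)) :
    HasFDerivAt (f ∘ φ) (fderivWithin ℝ f M (φ u) ∘L fderiv ℝ φ u) u :=
  (hf.hasFDerivWithinAt.comp u (h.hasFDerivAt hu).hasFDerivWithinAt h.mapsTo).hasFDerivAt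
    (h.isOpen_source.mem_nhds hu)

theorem restrict (h : IsLocalParametrization M U V φ ψ) {W : Set (EuclideanSpace ℝ (Fin m))}
    (hW : IsOpen W) (hWU : W ⊆ U) : IsLocalParametrization M W (V ∩ ψ ⁻¹' W) φ ψ where
  isOpen_source := hW
  isOpen_target := h.contDiffOn_inv.continuousOn.isOpen_inter_preimage h.isOpen_target hW
  contDiffOn := h.contDiffOn.mono hWU
  contDiffOn_inv := h.contDiffOn_inv.mono inter_subset_left
  image_eq := by
    ext y
    constructor
    · rintro ⟨u, hu, rfl⟩
      refine ⟨(h.mem (hWU hu)).1, (h.mem (hWU hu)).2, ?_⟩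
      rwa [mem_preimage, h.left_inv u (hWU hu)]
    · rintro ⟨hyM, hyV, hyW⟩
      exact ⟨ψ y, hyW, h.right_inv ⟨hyM, hyV⟩⟩
  left_inv := fun u hu => h.left_inv u (hWU hu)

/-- On `M ∩ V`, `f` equals `(f ∘ φ) ∘ ψ`; thus smoothness on `M` can be tested in a parametrization.
-/
theorem contDiffWithinAt_of_comp {F : Type*} [NormedAddCommGroup F] [NormedSpace ℝ F]
    (h : IsLocalParametrization M U V φ ψ) {u} (hu : u ∈ U)
    {f : EuclideanSpace ℝ (Fin n) → F} (hf : ContDiffOn ℝ ∞ (f ∘ φ) U) :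
    ContDiffWithinAt ℝ ∞ f M (φ u) := by
  have h1 : ContDiffOn ℝ ∞ ((f ∘ φ) ∘ ψ) (M ∩ V) :=
    hf.comp (h.contDiffOn_inv.mono inter_subset_right) h.mapsTo_inv
  have h2 : ContDiffOn ℝ ∞ f (M ∩ V) := h1.congr fun y hy => by
    simp only [Function.comp_apply, h.right_inv hy]
  exact (contDiffWithinAt_inter (h.isOpen_target.mem_nhds (h.mem hu).2)).1 (h2 _ (h.mem hu))

/-- The projection is self-adjoint and fixes tangent vectors, so the arbitrary normal part of the
derivative drops out. -/
theorem inner_manifoldGradient (h : IsLocalParametrization M U V φ ψ) {u} (hu : u ∈ U)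
    {f : EuclideanSpace ℝ (Fin n) → ℝ} (hf : DifferentiableWithinAt ℝ f M (φ u))
    (w : EuclideanSpace ℝ (Fin m)) :
    inner ℝ (manifoldGradient M f (φ u)) (fderiv ℝ φ u w) = fderiv ℝ (f ∘ φ) u w := by
  rw [manifoldGradient, Submodule.inner_starProjection_left_eq_right,
    Submodule.starProjection_eq_self_iff.2 (h.fderiv_mem_tangentSpaceAt hu w),
    inner_gradientWithin_left, (h.hasFDerivAt_comp hu hf).fderiv]
  rfl

theorem exists_fderiv_eq_manifoldGradient (h : IsLocalParametrization M U V φ ψ) {u} (hu : u ∈ U)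
    (f : EuclideanSpace ℝ (Fin n) → ℝ) :
    ∃ w, fderiv ℝ φ u w = manifoldGradient M f (φ u) := by
  have : manifoldGradient M f (φ u) ∈ tangentSpaceAt M (φ u) :=
    Submodule.starProjection_apply_mem _ _
  rwa [h.tangentSpaceAt_eq_range hu] at this

theorem measurableSet_image (h : IsLocalParametrization M U V φ ψ) {A} (hA : MeasurableSet A)
    (hAU : A ⊆ U) : MeasurableSet (φ '' A) :=
  hA.image_of_continuousOn_injOn (h.contDiffOn.continuousOn.mono hAU) (h.injOn.mono hAU)

/-- The area formula for a local parametrization. -/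
theorem euclideanHausdorffMeasure_image (h : IsLocalParametrization M U V φ ψ) {A}
    (hA : MeasurableSet A) (hAU : A ⊆ U) :
    μHE[m] (φ '' A) = ∫⁻ x in A, ENNReal.ofReal (fderiv ℝ φ x).toLinearMap.normDet :=
  euclideanHausdorffMeasure_image_eq_lintegral h.isOpen_source h.contDiffOn h.injOn
    (fun _ hu => h.injective_fderiv hu) hA hAU

/-- The square is a Gram determinant, polynomial in inner products of partial derivatives; it is
positive by injectivity, so its root is smooth. -/
theorem contDiffOn_normDet (h : IsLocalParametrization M U V φ ψ) :
    ContDiffOn ℝ ∞ (fun u => (fderiv ℝ φ u).toLinearMap.normDet) U := by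
  let b := EuclideanSpace.basisFun (Fin m) ℝ
  have h1 : ∀ u, (fderiv ℝ φ u).toLinearMap.normDet ^ 2 =
      (Matrix.gram ℝ fun i => fderiv ℝ φ u (b i)).det := fun u =>
    (fderiv ℝ φ u).toLinearMap.normDet_sq_eq_det_gram b
  have hd : ContDiffOn ℝ ∞ (fun u => (Matrix.gram ℝ fun i => fderiv ℝ φ u (b i)).det) U := by
    simp only [Matrix.det_apply, Matrix.gram_apply]
    have hf := h.contDiffOn.fderiv_of_isOpen (m := ∞) h.isOpen_source (by simp)
    have hv : ∀ i, ContDiffOn ℝ ∞ (fun u => fderiv ℝ φ u (b i)) U := fun i =>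
      hf.clm_apply contDiffOn_const
    refine ContDiffOn.sum fun σ _ => ?_
    refine ContDiffOn.const_smul _ (contDiffOn_prod fun i _ => ?_)
    exact (hv _).inner ℝ (hv _)
  have h2 : ContDiffOn ℝ ∞ (fun u => √((Matrix.gram ℝ fun i => fderiv ℝ φ u (b i)).det)) U := by
    refine hd.sqrt fun u hu => ?_
    rw [← h1]
    exact pow_ne_zero 2 (LinearMap.normDet_pos_of_injective (h.injective_fderiv hu)).ne'
  refine h2.congr fun u _ => ?_
  rw [← h1, Real.sqrt_sq (LinearMap.normDet_nonneg _)]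

theorem measurableSet_inter_preimage (h : IsLocalParametrization M U V φ ψ) {α : Type*}
    [MeasurableSpace α] [TopologicalSpace α] [BorelSpace α]
    {g : EuclideanSpace ℝ (Fin m) → α} (hg : ContinuousOn g U) {A} (hA : MeasurableSet A) :
    MeasurableSet (U ∩ g ⁻¹' A) := by
  have h1 : MeasurableSet (U.domRestrict g ⁻¹' A) :=
    hg.domRestrict.measurable hA
  have h2 := (MeasurableEmbedding.subtype_coe h.isOpen_source.measurableSet).measurableSet_image.2 h1
  convert h2 using 1
  ext x
  simp [and_comm]

/-- Integration over `M` in a local parametrization. -/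
theorem lintegral_image (h : IsLocalParametrization M U V φ ψ) {A} (hA : MeasurableSet A)
    (hAU : A ⊆ U) (f : EuclideanSpace ℝ (Fin n) → ℝ≥0∞) :
    ∫⁻ x in φ '' A, f x ∂μHE[m] =
      ∫⁻ u in A, ENNReal.ofReal (fderiv ℝ φ u).toLinearMap.normDet * f (φ u) := by
  have he : MeasurableEmbedding (A.domRestrict φ) :=
    (h.contDiffOn.continuousOn.mono hAU).measurableEmbedding hA (h.injOn.mono hAU)
  have hJ : AEMeasurable (fun u => ENNReal.ofReal (fderiv ℝ φ u).toLinearMap.normDet)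
      (volume.restrict A) :=
    ((h.contDiffOn_normDet.continuousOn.mono hAU).aemeasurable hA).ennreal_ofReal
  -- The area formula is an identity of measures. Pulling back along a measurable embedding then
  -- needs no measurability of `f`.
  have hmap : Measure.map (A.domRestrict φ) (Measure.comap (↑) (volume.withDensity fun u =>
      ENNReal.ofReal (fderiv ℝ φ u).toLinearMap.normDet)) = μHE[m].restrict (φ '' A) := by
    ext B hB
    have h1 : MeasurableSet (((↑) : A → EuclideanSpace ℝ (Fin m)) '' (A.domRestrict φ ⁻¹' B)) :=
      (MeasurableEmbedding.subtype_coe hA).measurableSet_image.2 (he.measurable hB)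
    have h2 : φ '' (((↑) : A → EuclideanSpace ℝ (Fin m)) '' (A.domRestrict φ ⁻¹' B)) =
        B ∩ φ '' A := by
      ext y
      simp only [mem_image, mem_preimage, Subtype.exists, mem_inter_iff, domRestrict_apply]
      grind
    rw [he.map_apply, (MeasurableEmbedding.subtype_coe hA).comap_apply, withDensity_apply _ h1,
      Measure.restrict_apply hB, ← h2, h.euclideanHausdorffMeasure_image h1]
    exact (Subtype.coe_image_subset _ _).trans hAU
  rw [← hmap, he.lintegral_map]
  simp only [domRestrict_apply]
  rw [← (MeasurableEmbedding.subtype_coe hA).lintegral_map (fun u => f (φ u)),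
    map_comap_subtype_coe hA,
    setLIntegral_withDensity_eq_setLIntegral_mul_non_measurable₀ _ hJ _ hA]
  · rfl
  · simp

end IsLocalParametrization

/-- Countably many of the sets `M ∩ V` cover `M`, and each is an injective continuous image of an
open set. -/
theorem IsSmoothSubmanifold.measurableSet {m n : ℕ}
    {M : Set (EuclideanSpace ℝ (Fin n))} (hM : IsSmoothSubmanifold m M) : MeasurableSet M := by
  choose! U V φ ψ h u hu hx using fun x (hx : x ∈ M) => hM.exists_isLocalParametrization hx
  obtain ⟨t, htM, htc, hcov⟩ := TopologicalSpace.countable_cover_nhdsWithin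
    (f := V) (s := M) fun x hxM => mem_nhdsWithin_of_mem_nhds
      ((h x hxM).isOpen_target.mem_nhds (by
        have := ((h x hxM).mem (hu x hxM)).2
        rwa [hx x hxM] at this))
  have : M = ⋃ x ∈ t, M ∩ V x := by
    rw [← inter_iUnion₂, inter_eq_left.2 hcov]
  rw [this]
  refine MeasurableSet.biUnion htc fun x hxt => ?_
  rw [← (h x (htM hxt)).image_eq]
  exact (h x (htM hxt)).measurableSet_image (h x (htM hxt)).isOpen_source.measurableSet subset_rfl

/-! ### Smooth embeddings and their volume elements -/

theorem volumeElement_eq_normDet {n d : ℕ} (M : Set (EuclideanSpace ℝ (Fin n)))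
    (E : EuclideanSpace ℝ (Fin n) → EuclideanSpace ℝ (Fin d)) (x : EuclideanSpace ℝ (Fin n)) :
    volumeElement M E x = (tangentialJacobian M E x).normDet := by
  have h := (tangentialJacobian M E x).normDet_sq
  simp only [RCLike.ofReal_real_eq_id, id] at h
  rw [volumeElement, ← h, Real.sqrt_sq (LinearMap.normDet_nonneg _)]

/-- A smooth map of Euclidean spaces with injective derivative at a point has, near this point, a
smooth left inverse defined on an open set. -/
theorem exists_contDiffOn_left_inverse {m d : ℕ} {U : Set (EuclideanSpace ℝ (Fin m))}
    (hU : IsOpen U) {g : EuclideanSpace ℝ (Fin m) → EuclideanSpace ℝ (Fin d)}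
    (hg : ContDiffOn ℝ ∞ g U) {u : EuclideanSpace ℝ (Fin m)} (hu : u ∈ U)
    (hinj : Function.Injective (fderiv ℝ g u)) :
    ∃ (W : Set (EuclideanSpace ℝ (Fin m))) (T : Set (EuclideanSpace ℝ (Fin d)))
      (χ : EuclideanSpace ℝ (Fin d) → EuclideanSpace ℝ (Fin m)),
      IsOpen W ∧ u ∈ W ∧ W ⊆ U ∧ IsOpen T ∧ MapsTo g W T ∧ ContDiffOn ℝ ∞ χ T ∧
        ∀ v ∈ W, χ (g v) = v := by
  -- For a linear left inverse `L` of the derivative, `L ∘ g` has derivative the identity at `u`;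
  -- the inverse function theorem gives `χ = (L ∘ g)⁻¹ ∘ L`.
  obtain ⟨L₀, hL₀⟩ := (fderiv ℝ g u).toLinearMap.exists_leftInverse_of_injective
    (LinearMap.ker_eq_bot.2 hinj)
  let L : EuclideanSpace ℝ (Fin d) →L[ℝ] EuclideanSpace ℝ (Fin m) := L₀.toContinuousLinearMap
  have hgu : ContDiffAt ℝ ∞ g u := hg.contDiffAt (hU.mem_nhds hu)
  have hk : ContDiffOn ℝ ∞ (fun v => L (g v)) U := L.contDiff.comp_contDiffOn hg
  have hku : ContDiffAt ℝ ∞ (fun v => L (g v)) u := hk.contDiffAt (hU.mem_nhds hu)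
  have hid : L ∘L fderiv ℝ g u = (ContinuousLinearEquiv.refl ℝ (EuclideanSpace ℝ (Fin m)) :
      EuclideanSpace ℝ (Fin m) →L[ℝ] EuclideanSpace ℝ (Fin m)) := by
    ext1 w
    exact LinearMap.congr_fun hL₀ w
  have hder : HasFDerivAt (fun v => L (g v)) (ContinuousLinearEquiv.refl ℝ
      (EuclideanSpace ℝ (Fin m)) : EuclideanSpace ℝ (Fin m) →L[ℝ] EuclideanSpace ℝ (Fin m)) u := by
    rw [← hid]
    exact L.hasFDerivAt.comp u (hgu.differentiableAt (by simp)).hasFDerivAt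
  let h := hku.toOpenPartialHomeomorph _ hder (by simp)
  have hcoe : (h : _ → _) = fun v => L (g v) := rfl
  -- Smoothness of the inverse is obtained point by point, so the derivative must be invertible on
  -- all of `W`.
  have hev : ∀ᶠ v in 𝓝 u, fderiv ℝ (fun v => L (g v)) v ∈ range ((↑) : (EuclideanSpace ℝ (Fin m)
      ≃L[ℝ] EuclideanSpace ℝ (Fin m)) → EuclideanSpace ℝ (Fin m) →L[ℝ] _) := by
    have hc : ContinuousAt (fderiv ℝ (fun v => L (g v))) u :=
      (hku.fderiv_right (m := 0) (by simp)).continuousAt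
    refine hc ?_
    rw [hder.fderiv]
    exact ContinuousLinearEquiv.nhds _
  obtain ⟨W, hWsub, hWo, huW⟩ := mem_nhds_iff.1 (inter_mem (inter_mem (hU.mem_nhds hu)
    (h.open_source.mem_nhds (hku.mem_toOpenPartialHomeomorph_source hder (by simp)))) hev)
  refine ⟨W, L ⁻¹' (h '' W), fun y => h.symm (L y), hWo, huW, fun x hx => (hWsub hx).1.1,
    (h.isOpen_image_of_subset_source hWo fun x hx => (hWsub hx).1.2).preimage L.continuous,
    fun v hv => ⟨v, hv, rfl⟩, ?_, fun v hv => h.left_inv (hWsub hv).1.2⟩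
  have hsymm : ContDiffOn ℝ ∞ h.symm (h '' W) := by
    rintro _ ⟨v, hv, rfl⟩
    obtain ⟨⟨hvU, hvs⟩, e, he⟩ := hWsub hv
    refine ContDiffAt.contDiffWithinAt (h.contDiffAt_symm (f₀' := e) (h.map_source hvs) ?_ ?_)
    · rw [h.left_inv hvs, he]
      exact ((hk.contDiffAt (hU.mem_nhds hvU)).differentiableAt (by simp)).hasFDerivAt
    · rw [h.left_inv hvs]
      exact hk.contDiffAt (hU.mem_nhds hvU)
  exact hsymm.comp L.contDiff.contDiffOn fun y hy => hy

namespace IsLocalParametrization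

variable {m n d : ℕ} {M : Set (EuclideanSpace ℝ (Fin n))}
    {U : Set (EuclideanSpace ℝ (Fin m))} {V : Set (EuclideanSpace ℝ (Fin n))}
    {φ : EuclideanSpace ℝ (Fin m) → EuclideanSpace ℝ (Fin n)}
    {ψ : EuclideanSpace ℝ (Fin n) → EuclideanSpace ℝ (Fin m)}
    {E : EuclideanSpace ℝ (Fin n) → EuclideanSpace ℝ (Fin d)}

theorem fderiv_comp_apply (h : IsLocalParametrization M U V φ ψ) (hE : ContDiffOn ℝ ∞ E M)
    {u} (hu : u ∈ U) (w : EuclideanSpace ℝ (Fin m)) :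
    fderiv ℝ (E ∘ φ) u w =
      tangentialJacobian M E (φ u) ⟨fderiv ℝ φ u w, h.fderiv_mem_tangentSpaceAt hu w⟩ := by
  rw [(h.hasFDerivAt_comp hu ((hE _ (h.mem hu).1).differentiableWithinAt (by simp))).fderiv]
  rfl

theorem normDet_fderiv_comp (h : IsLocalParametrization M U V φ ψ) (hE : ContDiffOn ℝ ∞ E M)
    {u} (hu : u ∈ U) :
    (fderiv ℝ (E ∘ φ) u).toLinearMap.normDet =
      volumeElement M E (φ u) * (fderiv ℝ φ u).toLinearMap.normDet := by
  rw [volumeElement_eq_normDet, tangentialJacobian, h.tangentSpaceAt_eq_range hu,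
    (h.hasFDerivAt_comp hu ((hE _ (h.mem hu).1).differentiableWithinAt (by simp))).fderiv]
  exact LinearMap.normDet_comp _ _

/-- An embedding that is an immersion carries small local parametrizations of `M` to local
parametrizations of the image. -/
theorem exists_comp (h : IsLocalParametrization M U V φ ψ) (hE : ContDiffOn ℝ ∞ E M)
    (hEmb : Topology.IsEmbedding (M.domRestrict E)) {u} (hu : u ∈ U)
    (hinj : Function.Injective (tangentialJacobian M E (φ u))) :
    ∃ U' V' W' χ, u ∈ U' ∧ IsLocalParametrization M U' V' φ ψ ∧
      IsLocalParametrization (E '' M) U' W' (E ∘ φ) χ := by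
  have hg : ContDiffOn ℝ ∞ (E ∘ φ) U := hE.comp h.contDiffOn h.mapsTo
  have hginj : Function.Injective (fderiv ℝ (E ∘ φ) u) := by
    intro a b hab
    rw [h.fderiv_comp_apply hE hu, h.fderiv_comp_apply hE hu] at hab
    exact h.injective_fderiv hu (congrArg Subtype.val (hinj hab))
  obtain ⟨W, T, χ, hWo, huW, hWU, hT, hWT, hχ, hleft⟩ :=
    exists_contDiffOn_left_inverse h.isOpen_source hg hu hginj
  have h' := h.restrict hWo hWU
  -- The homeomorphism hypothesis enters here: intersecting with `O` excludes other parts of `M`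
  -- whose images come close to `E (φ u)`.
  obtain ⟨O, hO, hOeq⟩ := hEmb.isInducing.isOpen_iff.1
    (h'.isOpen_target.preimage continuous_subtype_val : IsOpen (((↑) : M → EuclideanSpace ℝ (Fin n)) ⁻¹' _))
  have hO' : ∀ x ∈ M, E x ∈ O ↔ x ∈ V ∩ ψ ⁻¹' W := fun x hx => by
    have := congrArg (fun s : Set M => (⟨x, hx⟩ : M) ∈ s) hOeq
    simpa using this
  refine ⟨W, _, O ∩ T, χ, huW, h', hWo, hO.inter hT, hg.mono hWU, hχ.mono inter_subset_right, ?_,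
    hleft⟩
  rw [image_comp, h'.image_eq]
  ext z
  constructor
  · rintro ⟨x, hx, rfl⟩
    refine ⟨mem_image_of_mem E hx.1, (hO' x hx.1).2 hx.2, ?_⟩
    have := hWT hx.2.2
    rwa [Function.comp_apply, h'.right_inv hx] at this
  · rintro ⟨⟨x, hx, rfl⟩, hxO, -⟩
    exact mem_image_of_mem E ⟨hx, (hO' x hx).1 hxO⟩

end IsLocalParametrization

/-- `E` is a smooth embedding of the submanifold `M`: an immersion and a homeomorphism onto
its image. -/
structure IsSmoothEmbeddingOn (m : ℕ) {n d : ℕ} (M : Set (EuclideanSpace ℝ (Fin n)))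
    (E : EuclideanSpace ℝ (Fin n) → EuclideanSpace ℝ (Fin d)) : Prop where
  isSmoothSubmanifold : IsSmoothSubmanifold m M
  contDiffOn : ContDiffOn ℝ ∞ E M
  isEmbedding : Topology.IsEmbedding (M.domRestrict E)
  injective : ∀ x ∈ M, Function.Injective (tangentialJacobian M E x)

namespace IsSmoothEmbeddingOn

variable {m n d : ℕ} {M : Set (EuclideanSpace ℝ (Fin n))}
    {E : EuclideanSpace ℝ (Fin n) → EuclideanSpace ℝ (Fin d)}

theorem exists_isLocalParametrization (h : IsSmoothEmbeddingOn m M E) {x} (hx : x ∈ M) :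
    ∃ U V W φ ψ χ, IsLocalParametrization (m := m) M U V φ ψ ∧
      IsLocalParametrization (m := m) (E '' M) U W (E ∘ φ) χ ∧ ∃ u ∈ U, φ u = x := by
  obtain ⟨U, V, φ, ψ, h1, u, hu, rfl⟩ := h.isSmoothSubmanifold.exists_isLocalParametrization hx
  obtain ⟨U', V', W', χ, hu', h2, h3⟩ := h1.exists_comp h.contDiffOn h.isEmbedding hu
    (h.injective _ hx)
  exact ⟨U', V', W', φ, ψ, χ, h2, h3, u, hu', rfl⟩

theorem injOn (h : IsSmoothEmbeddingOn m M E) : InjOn E M :=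
  injOn_iff_injective.2 h.isEmbedding.injective

theorem isSmoothSubmanifold_image (h : IsSmoothEmbeddingOn m M E) :
    IsSmoothSubmanifold m (E '' M) := by
  rintro _ ⟨x, hx, rfl⟩
  obtain ⟨U, V, W, φ, ψ, χ, -, h2, u, hu, rfl⟩ := h.exists_isLocalParametrization hx
  exact ⟨U, W, E ∘ φ, χ, h2.isOpen_source, h2.isOpen_target, (h2.mem hu).2, h2.contDiffOn,
    h2.contDiffOn_inv, h2.image_eq, h2.left_inv⟩

theorem volumeElement_pos (h : IsSmoothEmbeddingOn m M E) {x} (hx : x ∈ M) :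
    0 < volumeElement M E x := by
  rw [volumeElement_eq_normDet]
  exact LinearMap.normDet_pos_of_injective (h.injective x hx)

/-- In a common parametrization it is the quotient of the area densities of `E ∘ φ` and `φ`. -/
theorem contDiffOn_volumeElement (h : IsSmoothEmbeddingOn m M E) :
    ContDiffOn ℝ ∞ (volumeElement M E) M := by
  intro x hx
  obtain ⟨U, V, W, φ, ψ, χ, h1, h2, u, hu, rfl⟩ := h.exists_isLocalParametrization hx
  refine h1.contDiffWithinAt_of_comp hu ?_
  have hpos : ∀ v ∈ U, 0 < (fderiv ℝ φ v).toLinearMap.normDet := fun v hv =>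
    LinearMap.normDet_pos_of_injective (h1.injective_fderiv hv)
  refine (h2.contDiffOn_normDet.div h1.contDiffOn_normDet fun v hv => (hpos v hv).ne').congr ?_
  intro v hv
  rw [Pi.div_apply, h1.normDet_fderiv_comp h.contDiffOn hv, Function.comp_apply,
    mul_div_cancel_right₀ _ (hpos v hv).ne']

end IsSmoothEmbeddingOn

/-! ### Densities and push-forward -/

/-- Restricted to `M`, `E` is a measurable embedding, so `f` may be arbitrary; this avoids proving
that the squared norm of the score is measurable. -/
theorem lintegral_map_of_injOn {X Y : Type*} [TopologicalSpace X] [PolishSpace X]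
    [MeasurableSpace X] [BorelSpace X] [TopologicalSpace Y] [T2Space Y]
    [SecondCountableTopology Y] [MeasurableSpace Y]
    [BorelSpace Y] {P : Measure X} {M : Set X} (hM : MeasurableSet M) {E : X → Y}
    (hE : ContinuousOn E M) (hinj : InjOn E M) (hP : ∀ᵐ x ∂P, x ∈ M) (f : Y → ℝ≥0∞) :
    ∫⁻ z, f z ∂(P.map E) = ∫⁻ x, f (E x) ∂P := by
  have he : MeasurableEmbedding (M.domRestrict E) := hE.measurableEmbedding hM hinj
  have hPc : (P.comap ((↑) : M → X)).map (↑) = P := by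
    rw [map_comap_subtype_coe hM, Measure.restrict_eq_self_of_ae_mem hP]
  have hEm : AEMeasurable E ((P.comap ((↑) : M → X)).map (↑)) := by
    rw [map_comap_subtype_coe hM]
    exact hE.aemeasurable hM
  have h1 : P.map E = (P.comap ((↑) : M → X)).map (M.domRestrict E) := by
    rw [domRestrict_eq, ← AEMeasurable.map_map_of_aemeasurable hEm
      measurable_subtype_coe.aemeasurable, hPc]
  rw [h1, he.lintegral_map]
  simp only [domRestrict_apply]
  rw [← (MeasurableEmbedding.subtype_coe hM).lintegral_map (fun x => f (E x)), hPc]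

namespace IsSmoothPosDensity

variable {m n : ℕ} {M : Set (EuclideanSpace ℝ (Fin n))}
    {P : Measure (EuclideanSpace ℝ (Fin n))} {p : EuclideanSpace ℝ (Fin n) → ℝ}
    {U : Set (EuclideanSpace ℝ (Fin m))} {V : Set (EuclideanSpace ℝ (Fin n))}
    {φ : EuclideanSpace ℝ (Fin m) → EuclideanSpace ℝ (Fin n)}
    {ψ : EuclideanSpace ℝ (Fin n) → EuclideanSpace ℝ (Fin m)}

theorem absolutelyContinuous (h : IsSmoothPosDensity m M P p) : P ≪ μHE[m].restrict M := by
  rw [h.eq_withDensity]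
  exact withDensity_absolutelyContinuous _ _

theorem ae_mem (h : IsSmoothPosDensity m M P p) (hM : MeasurableSet M) : ∀ᵐ x ∂P, x ∈ M :=
  h.absolutelyContinuous.ae_le (ae_restrict_mem hM)

theorem measure_image (h : IsSmoothPosDensity m M P p) (hφ : IsLocalParametrization M U V φ ψ)
    {A : Set (EuclideanSpace ℝ (Fin m))} (hA : MeasurableSet A) (hAU : A ⊆ U) :
    P (φ '' A) = ∫⁻ u in A, ENNReal.ofReal ((fderiv ℝ φ u).toLinearMap.normDet * p (φ u)) := by
  have hm := hφ.measurableSet_image hA hAU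
  rw [h.eq_withDensity, withDensity_apply _ hm, riemannianVolume, Measure.restrict_restrict hm,
    inter_eq_left.2 (hφ.mapsTo.mono_left hAU).image_subset, hφ.lintegral_image hA hAU]
  simp only [ENNReal.ofReal_mul (LinearMap.normDet_nonneg _)]

/-- The smooth density with respect to the Riemannian volume is unique. -/
theorem eqOn [IsFiniteMeasure P] (hM : IsSmoothSubmanifold m M)
    {p₁ p₂ : EuclideanSpace ℝ (Fin n) → ℝ}
    (h₁ : IsSmoothPosDensity m M P p₁) (h₂ : IsSmoothPosDensity m M P p₂) : EqOn p₁ p₂ M := by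
  intro x hx
  obtain ⟨U, V, φ, ψ, h, u, hu, rfl⟩ := hM.exists_isLocalParametrization hx
  have hcont : ∀ p, IsSmoothPosDensity m M P p →
      ContinuousOn (fun u => (fderiv ℝ φ u).toLinearMap.normDet * p (φ u)) U := fun p hp =>
    h.contDiffOn_normDet.continuousOn.mul
      (hp.smooth.continuousOn.comp h.contDiffOn.continuousOn h.mapsTo)
  have hUm := h.isOpen_source.measurableSet
  have hint : ∀ p, IsSmoothPosDensity m M P p → ∀ A, MeasurableSet A →
      ∫⁻ u in A, ENNReal.ofReal ((fderiv ℝ φ u).toLinearMap.normDet * p (φ u)) ∂volume.restrict U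
        = P (φ '' (A ∩ U)) := fun p hp A hA => by
    rw [Measure.restrict_restrict hA, hp.measure_image h (hA.inter hUm) inter_subset_right]
  -- Both have integral `P (φ '' (A ∩ U))` over `A`, which is finite. Continuity then upgrades
  -- almost everywhere to everywhere on the open set `U`.
  have hae : (fun u => ENNReal.ofReal ((fderiv ℝ φ u).toLinearMap.normDet * p₁ (φ u)))
      =ᵐ[volume.restrict U]
      fun u => ENNReal.ofReal ((fderiv ℝ φ u).toLinearMap.normDet * p₂ (φ u)) := by
    refine AEMeasurable.ae_eq_of_forall_setLIntegral_eq
      ((hcont _ h₁).aemeasurable hUm).ennreal_ofReal ((hcont _ h₂).aemeasurable hUm).ennreal_ofReal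
      ?_ ?_ fun A hA _ => by rw [hint _ h₁ A hA, hint _ h₂ A hA]
    all_goals rw [← setLIntegral_univ]
    · rw [hint _ h₁ _ MeasurableSet.univ]
      exact measure_ne_top _ _
    · rw [hint _ h₂ _ MeasurableSet.univ]
      exact measure_ne_top _ _
  have heq := Measure.eqOn_open_of_ae_eq hae h.isOpen_source
    (ENNReal.continuous_ofReal.comp_continuousOn (hcont _ h₁))
    (ENNReal.continuous_ofReal.comp_continuousOn (hcont _ h₂)) hu
  have hJ := LinearMap.normDet_pos_of_injective (f := (fderiv ℝ φ u).toLinearMap)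
    (h.injective_fderiv hu)
  have := (ENNReal.ofReal_eq_ofReal_iff (mul_nonneg hJ.le (h₁.pos _ hx).le)
    (mul_nonneg hJ.le (h₂.pos _ hx).le)).1 heq
  exact mul_left_cancel₀ hJ.ne' this

end IsSmoothPosDensity

namespace IsSmoothEmbeddingOn

variable {m n d : ℕ} {M : Set (EuclideanSpace ℝ (Fin n))}
    {E : EuclideanSpace ℝ (Fin n) → EuclideanSpace ℝ (Fin d)}
    {P : Measure (EuclideanSpace ℝ (Fin n))} {p : EuclideanSpace ℝ (Fin n) → ℝ}

theorem aemeasurable (h : IsSmoothEmbeddingOn m M E) (hp : IsSmoothPosDensity m M P p) :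
    AEMeasurable E P :=
  (h.contDiffOn.continuousOn.aemeasurable h.isSmoothSubmanifold.measurableSet).mono_ac
    hp.absolutelyContinuous

/-- Change of variables: the push-forward measure has density `p / volumeElement`. -/
theorem map_eq_withDensity (h : IsSmoothEmbeddingOn m M E) (hp : IsSmoothPosDensity m M P p)
    {q : EuclideanSpace ℝ (Fin d) → ℝ} (hq : ∀ x ∈ M, q (E x) = p x / volumeElement M E x) :
    P.map E = (riemannianVolume m (E '' M)).withDensity fun z => ENNReal.ofReal (q z) := by
  have hMm := h.isSmoothSubmanifold.measurableSet
  have hNm := h.isSmoothSubmanifold_image.measurableSet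
  have hEm := h.aemeasurable hp
  choose! U V W φ ψ χ h1 h2 u hu hx using
    fun x (hx : x ∈ M) => h.exists_isLocalParametrization hx
  have hxW : ∀ x ∈ M, E x ∈ W x := fun x hxM => by
    have := ((h2 x hxM).mem (hu x hxM)).2
    rwa [Function.comp_apply, hx x hxM] at this
  let r : EuclideanSpace ℝ (Fin d) → EuclideanSpace ℝ (Fin n) := Function.invFunOn E M
  have hr : ∀ z ∈ E '' M, r z ∈ M ∧ E (r z) = z := fun z hz =>
    ⟨Function.invFunOn_mem hz, Function.invFunOn_eq hz⟩
  obtain ⟨t, htN, htc, hcov⟩ := TopologicalSpace.countable_cover_nhdsWithin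
    (f := fun z => W (r z)) (s := E '' M) fun z hz => mem_nhdsWithin_of_mem_nhds
      ((h2 _ (hr z hz).1).isOpen_target.mem_nhds (by
        have := hxW _ (hr z hz).1
        rwa [(hr z hz).2] at this))
  -- Both measures are concentrated on `E '' M`, so agreement on each set of a countable open cover
  -- suffices.
  have hloc : ∀ z ∈ t, (P.map E).restrict (W (r z)) =
      ((riemannianVolume m (E '' M)).withDensity fun z => ENNReal.ofReal (q z)).restrict
        (W (r z)) := by
    intro z hz
    obtain ⟨hrM, -⟩ := hr z (htN hz)
    have k1 := h1 _ hrM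
    have k2 := h2 _ hrM
    ext A hA
    rw [Measure.restrict_apply hA, Measure.restrict_apply hA]
    have hAW := hA.inter k2.isOpen_target.measurableSet
    have hB := k2.measurableSet_inter_preimage k2.contDiffOn.continuousOn hA
    have him : (E ∘ φ (r z)) '' (U (r z) ∩ (E ∘ φ (r z)) ⁻¹' A) = A ∩ W (r z) ∩ E '' M := by
      rw [image_inter_preimage, k2.image_eq]
      ac_rfl
    -- As `E` is injective on `M`, the equality may be checked after applying `E`.
    have him' : φ (r z) '' (U (r z) ∩ (E ∘ φ (r z)) ⁻¹' A) =
        M ∩ E ⁻¹' (A ∩ W (r z)) := by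
      refine (h.injOn.image_eq_image_iff (k1.mapsTo.mono_left inter_subset_left).image_subset
        inter_subset_left).1 ?_
      rw [← image_comp, him, image_inter_preimage, inter_comm]
    rw [Measure.map_apply_of_aemeasurable hEm hAW, withDensity_apply _ hAW, riemannianVolume,
      Measure.restrict_restrict hAW, ← him, k2.lintegral_image hB inter_subset_left,
      ← Measure.measure_inter_eq_of_ae (hp.ae_mem hMm), ← him',
      hp.measure_image k1 hB inter_subset_left]
    refine setLIntegral_congr_fun hB fun v hv => ?_
    have hvM := k1.mapsTo hv.1
    have hpos := h.volumeElement_pos hvM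
    simp only [Function.comp_apply]
    rw [← ENNReal.ofReal_mul (LinearMap.normDet_nonneg _), hq _ hvM]
    congr 1
    rw [k1.normDet_fderiv_comp h.contDiffOn hv.1]
    field_simp
  have hmap : ∀ᵐ z ∂(P.map E), z ∈ E '' M := by
    refine (mem_ae_map_iff hEm hNm).2 ?_
    exact (hp.ae_mem hMm).mono fun x hx => mem_image_of_mem E hx
  have hvol : ∀ᵐ z ∂((riemannianVolume m (E '' M)).withDensity fun z => ENNReal.ofReal (q z)),
      z ∈ E '' M :=
    (withDensity_absolutelyContinuous _ _).ae_le (ae_restrict_mem hNm)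
  rw [← Measure.restrict_eq_self_of_ae_mem (hmap.mono fun z hz => hcov hz),
    (Measure.restrict_biUnion_congr htc).2 hloc,
    Measure.restrict_eq_self_of_ae_mem (hvol.mono fun z hz => hcov hz)]

theorem exists_isSmoothPosDensity (h : IsSmoothEmbeddingOn m M E)
    (hp : IsSmoothPosDensity m M P p) :
    ∃ q, IsSmoothPosDensity m (E '' M) (P.map E) q ∧
      ∀ x ∈ M, q (E x) = p x / volumeElement M E x := by
  let q : EuclideanSpace ℝ (Fin d) → ℝ := fun z =>
    p (Function.invFunOn E M z) / volumeElement M E (Function.invFunOn E M z)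
  have hq : ∀ x ∈ M, q (E x) = p x / volumeElement M E x := fun x hx => by
    simp only [q, h.injOn.leftInvOn_invFunOn hx]
  refine ⟨q, ⟨?_, ?_, h.map_eq_withDensity hp hq⟩, hq⟩
  · rintro _ ⟨x, hx, rfl⟩
    obtain ⟨U, V, W, φ, ψ, χ, h1, h2, u, hu, rfl⟩ := h.exists_isLocalParametrization hx
    refine h2.contDiffWithinAt_of_comp hu ?_
    refine (((hp.smooth.div h.contDiffOn_volumeElement fun x hx =>
      (h.volumeElement_pos hx).ne').comp h1.contDiffOn h1.mapsTo)).congr fun v hv => ?_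
    exact hq _ (h1.mapsTo hv)
  · rintro _ ⟨x, hx, rfl⟩
    rw [hq x hx]
    exact div_pos (hp.pos x hx) (h.volumeElement_pos hx)

end IsSmoothEmbeddingOn

/-! ### Comparison of scores and Fisher informations -/

/-- The gradients of functions that correspond to each other under a map with derivative bounded
by `c` and `C` are comparable. -/
theorem IsLocalParametrization.norm_manifoldGradient_le {m n d : ℕ}
    {M : Set (EuclideanSpace ℝ (Fin n))} {N : Set (EuclideanSpace ℝ (Fin d))}
    {U : Set (EuclideanSpace ℝ (Fin m))}
    {V : Set (EuclideanSpace ℝ (Fin n))} {W : Set (EuclideanSpace ℝ (Fin d))}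
    {φ : EuclideanSpace ℝ (Fin m) → EuclideanSpace ℝ (Fin n)}
    {ψ : EuclideanSpace ℝ (Fin n) → EuclideanSpace ℝ (Fin m)}
    {g : EuclideanSpace ℝ (Fin m) → EuclideanSpace ℝ (Fin d)}
    {χ : EuclideanSpace ℝ (Fin d) → EuclideanSpace ℝ (Fin m)}
    (hφ : IsLocalParametrization M U V φ ψ) (hg : IsLocalParametrization N U W g χ)
    {u : EuclideanSpace ℝ (Fin m)} (hu : u ∈ U)
    {f : EuclideanSpace ℝ (Fin n) → ℝ} (hf : DifferentiableWithinAt ℝ f M (φ u))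
    {k : EuclideanSpace ℝ (Fin d) → ℝ} (hk : DifferentiableWithinAt ℝ k N (g u))
    (hfk : fderiv ℝ (k ∘ g) u = fderiv ℝ (f ∘ φ) u) {C : ℝ} (hC0 : 0 ≤ C)
    (hC : ∀ w, ‖fderiv ℝ g u w‖ ≤ C * ‖fderiv ℝ φ u w‖) :
    ‖manifoldGradient M f (φ u)‖ ≤ C * ‖manifoldGradient N k (g u)‖ := by
  -- Evaluating the common differential at `w` gives the squared norm of `∇f` on one side;
  -- Cauchy–Schwarz bounds the other.
  obtain ⟨w, hw⟩ := hφ.exists_fderiv_eq_manifoldGradient hu f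
  rcases (norm_nonneg (manifoldGradient M f (φ u))).eq_or_lt with h0 | h0
  · rw [← h0]
    positivity
  · refine le_of_mul_le_mul_right ?_ h0
    calc ‖manifoldGradient M f (φ u)‖ * ‖manifoldGradient M f (φ u)‖
        = inner ℝ (manifoldGradient M f (φ u)) (fderiv ℝ φ u w) := by
          rw [hw, real_inner_self_eq_norm_mul_norm]
      _ = inner ℝ (manifoldGradient N k (g u)) (fderiv ℝ g u w) := by
          rw [hφ.inner_manifoldGradient hu hf, hg.inner_manifoldGradient hu hk, hfk]
      _ ≤ ‖manifoldGradient N k (g u)‖ * ‖fderiv ℝ g u w‖ := real_inner_le_norm _ _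
      _ ≤ ‖manifoldGradient N k (g u)‖ * (C * ‖manifoldGradient M f (φ u)‖) := by
          gcongr
          rw [← hw]
          exact hC w
      _ = _ := by ring

namespace IsSmoothEmbeddingOn

variable {m n d : ℕ} {M : Set (EuclideanSpace ℝ (Fin n))}
    {E : EuclideanSpace ℝ (Fin n) → EuclideanSpace ℝ (Fin d)}
    {P : Measure (EuclideanSpace ℝ (Fin n))} {p : EuclideanSpace ℝ (Fin n) → ℝ}
    {q : EuclideanSpace ℝ (Fin d) → ℝ}

/-- The scores of `P` and of its push-forward are comparable if `E` has constant volume element. -/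
theorem norm_manifoldGradient_log_le (h : IsSmoothEmbeddingOn m M E) [IsFiniteMeasure P]
    (hp : IsSmoothPosDensity m M P p) (hq : IsSmoothPosDensity m (E '' M) (P.map E) q)
    {c C : ℝ} (hc : 0 < c) (hC : 0 < C)
    (hbd : ∀ x ∈ M, ∀ v : tangentSpaceAt M x,
      c * ‖v‖ ≤ ‖tangentialJacobian M E x v‖ ∧ ‖tangentialJacobian M E x v‖ ≤ C * ‖v‖)
    (hvol : ∀ x ∈ M, manifoldGradient M (fun y => Real.log (volumeElement M E y)) x = 0)
    {x : EuclideanSpace ℝ (Fin n)} (hx : x ∈ M) :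
    ‖manifoldGradient M (fun y => Real.log (p y)) x‖ ≤
        C * ‖manifoldGradient (E '' M) (fun y => Real.log (q y)) (E x)‖ ∧
      ‖manifoldGradient (E '' M) (fun y => Real.log (q y)) (E x)‖ ≤
        1 / c * ‖manifoldGradient M (fun y => Real.log (p y)) x‖ := by
  obtain ⟨q', hq', hqp'⟩ := h.exists_isSmoothPosDensity hp
  -- `q` is an arbitrary smooth density, so uniqueness is needed to identify it.
  have hqp : ∀ x ∈ M, q (E x) = p x / volumeElement M E x := fun x hx => by
    rw [hq.eqOn h.isSmoothSubmanifold_image hq' (mem_image_of_mem E hx), hqp' x hx]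
  obtain ⟨U, V, W, φ, ψ, χ, h1, h2, u, hu, rfl⟩ := h.exists_isLocalParametrization hx
  have hlog : ∀ {k : ℕ} {S : Set (EuclideanSpace ℝ (Fin k))} {f : EuclideanSpace ℝ (Fin k) → ℝ}
      {y}, ContDiffOn ℝ ∞ f S → (∀ y ∈ S, 0 < f y) → y ∈ S →
      DifferentiableWithinAt ℝ (fun y => Real.log (f y)) S y := fun hf hpos hy =>
    ((hf _ hy).differentiableWithinAt (by simp)).log (hpos _ hy).ne'
  have dp := hlog hp.smooth hp.pos hx
  have dq := hlog hq.smooth hq.pos (mem_image_of_mem E hx)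
  have dv := hlog h.contDiffOn_volumeElement (fun y hy => h.volumeElement_pos hy) hx
  have hv0 : fderiv ℝ ((fun y => Real.log (volumeElement M E y)) ∘ φ) u = 0 := by
    ext1 w
    rw [← h1.inner_manifoldGradient hu dv, hvol _ hx, inner_zero_left]
    rfl
  have hder : fderiv ℝ ((fun y => Real.log (q y)) ∘ (E ∘ φ)) u =
      fderiv ℝ ((fun y => Real.log (p y)) ∘ φ) u := by
    have hev : ((fun y => Real.log (q y)) ∘ (E ∘ φ)) =ᶠ[𝓝 u]
        ((fun y => Real.log (p y)) ∘ φ) - ((fun y => Real.log (volumeElement M E y)) ∘ φ) := by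
      filter_upwards [h1.isOpen_source.mem_nhds hu] with v hv
      have hvM := h1.mapsTo hv
      simp only [Function.comp_apply, Pi.sub_apply]
      rw [hqp _ hvM, Real.log_div (hp.pos _ hvM).ne' (h.volumeElement_pos hvM).ne']
    rw [hev.fderiv_eq, fderiv_sub (h1.hasFDerivAt_comp hu dp).differentiableAt
      (h1.hasFDerivAt_comp hu dv).differentiableAt, hv0, sub_zero]
  have hb : ∀ w, c * ‖fderiv ℝ φ u w‖ ≤ ‖fderiv ℝ (E ∘ φ) u w‖ ∧
      ‖fderiv ℝ (E ∘ φ) u w‖ ≤ C * ‖fderiv ℝ φ u w‖ := fun w => by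
    rw [h1.fderiv_comp_apply h.contDiffOn hu]
    exact hbd (φ u) hx ⟨fderiv ℝ φ u w, h1.fderiv_mem_tangentSpaceAt hu w⟩
  -- The second inequality is the first with `M` and `E '' M` exchanged and `1 / c` in place of `C`.
  refine ⟨h1.norm_manifoldGradient_le h2 hu dp dq hder hC.le fun w => (hb w).2,
    h2.norm_manifoldGradient_le h1 hu dq dp hder.symm (by positivity) fun w => ?_⟩
  rw [one_div, ← div_eq_inv_mul, le_div_iff₀' hc]
  exact (hb w).1

theorem manifoldFisherInformation_map (h : IsSmoothEmbeddingOn m M E)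
    (hp : IsSmoothPosDensity m M P p) :
    manifoldFisherInformation (E '' M) (P.map E) q =
      ∫⁻ x, ‖manifoldGradient (E '' M) (fun y => Real.log (q y)) (E x)‖ₑ ^ 2 ∂P :=
  lintegral_map_of_injOn h.isSmoothSubmanifold.measurableSet h.contDiffOn.continuousOn h.injOn
    (hp.ae_mem h.isSmoothSubmanifold.measurableSet) _

theorem manifoldFisherInformation_bounds (h : IsSmoothEmbeddingOn m M E) [IsFiniteMeasure P]
    (hp : IsSmoothPosDensity m M P p) (hq : IsSmoothPosDensity m (E '' M) (P.map E) q)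
    {c C : ℝ} (hc : 0 < c) (hC : 0 < C)
    (hbd : ∀ x ∈ M, ∀ v : tangentSpaceAt M x,
      c * ‖v‖ ≤ ‖tangentialJacobian M E x v‖ ∧ ‖tangentialJacobian M E x v‖ ≤ C * ‖v‖)
    (hvol : ∀ x ∈ M, manifoldGradient M (fun y => Real.log (volumeElement M E y)) x = 0) :
    ENNReal.ofReal (1 / C ^ 2) * manifoldFisherInformation M P p
        ≤ manifoldFisherInformation (E '' M) (P.map E) q ∧
      manifoldFisherInformation (E '' M) (P.map E) q
        ≤ ENNReal.ofReal (1 / c ^ 2) * manifoldFisherInformation M P p := by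
  have hae := hp.ae_mem h.isSmoothSubmanifold.measurableSet
  have key : ∀ {a b t : ℝ}, 0 ≤ a → 0 ≤ t → a ≤ t * b →
      ENNReal.ofReal a ^ 2 ≤ ENNReal.ofReal (t ^ 2) * ENNReal.ofReal b ^ 2 := by
    intro a b t ha ht hab
    rw [ENNReal.ofReal_pow ht, ← mul_pow, ← ENNReal.ofReal_mul ht]
    gcongr
  rw [h.manifoldFisherInformation_map hp, manifoldFisherInformation,
    -- Finite constants move into the integral without measurability of the integrand.
    ← lintegral_const_mul' _ _ ENNReal.ofReal_ne_top,
    ← lintegral_const_mul' _ _ ENNReal.ofReal_ne_top]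
  constructor
  · refine lintegral_mono_ae (hae.mono fun x hx => ?_)
    have := (h.norm_manifoldGradient_log_le hp hq hc hC hbd hvol hx).1
    rw [← ofReal_norm, ← ofReal_norm, one_div, ENNReal.ofReal_inv_of_pos (by positivity),
      ENNReal.inv_mul_le_iff (by simpa using hC.ne') ENNReal.ofReal_ne_top]
    exact key (norm_nonneg _) hC.le this
  · refine lintegral_mono_ae (hae.mono fun x hx => ?_)
    have := (h.norm_manifoldGradient_log_le hp hq hc hC hbd hvol hx).2
    rw [← ofReal_norm, ← ofReal_norm, ← one_div_pow]
    exact key (norm_nonneg _) (by positivity) this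

end IsSmoothEmbeddingOn

/-! ### The isometric case and the conclusion -/

theorem manifoldGradient_eq_zero_of_eqOn_const {n : ℕ} {M : Set (EuclideanSpace ℝ (Fin n))}
    {f : EuclideanSpace ℝ (Fin n) → ℝ} {a : ℝ} (hf : ∀ x ∈ M, f x = a)
    {x : EuclideanSpace ℝ (Fin n)} (hx : x ∈ M) : manifoldGradient M f x = 0 := by
  have h : fderivWithin ℝ f M x = 0 := by
    rw [fderivWithin_congr (f := fun _ => a) hf (hf x hx)]
    simp
  rw [manifoldGradient, gradientWithin, h, map_zero, map_zero]

theorem volumeElement_eq_one_of_isometry {n d : ℕ} {M : Set (EuclideanSpace ℝ (Fin n))}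
    {E : EuclideanSpace ℝ (Fin n) → EuclideanSpace ℝ (Fin d)} {x : EuclideanSpace ℝ (Fin n)}
    (h : ∀ v : tangentSpaceAt M x, ‖tangentialJacobian M E x v‖ = ‖v‖) :
    volumeElement M E x = 1 := by
  rw [volumeElement_eq_normDet]
  exact (⟨tangentialJacobian M E x, h⟩ :
    tangentSpaceAt M x →ₗᵢ[ℝ] EuclideanSpace ℝ (Fin d)).normDet_eq_one

theorem mainTheorem2 {m d D : ℕ}
    (M : Set (EuclideanSpace ℝ (Fin D))) (hM : IsSmoothSubmanifold m M)
    (E : EuclideanSpace ℝ (Fin D) → EuclideanSpace ℝ (Fin d)) (hE : ContDiffOn ℝ ∞ E M)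
    (hEmb : Topology.IsEmbedding (M.domRestrict E))
    (P : Measure (EuclideanSpace ℝ (Fin D))) [IsProbabilityMeasure P]
    (p : EuclideanSpace ℝ (Fin D) → ℝ) (hp : IsSmoothPosDensity m M P p) :
    (∀ c C : ℝ, 0 < c → 0 < C →
      (∀ x ∈ M, ∀ v : tangentSpaceAt M x,
        c * ‖v‖ ≤ ‖tangentialJacobian M E x v‖ ∧ ‖tangentialJacobian M E x v‖ ≤ C * ‖v‖) →
      (∀ x ∈ M, manifoldGradient M (fun y => Real.log (volumeElement M E y)) x = 0) →
      IsSmoothSubmanifold m (E '' M) ∧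
      (∃ q, IsSmoothPosDensity m (E '' M) (P.map E) q) ∧
      ∀ q, IsSmoothPosDensity m (E '' M) (P.map E) q →
        ENNReal.ofReal (1 / C ^ 2) * manifoldFisherInformation M P p
            ≤ manifoldFisherInformation (E '' M) (P.map E) q ∧
        manifoldFisherInformation (E '' M) (P.map E) q
            ≤ ENNReal.ofReal (1 / c ^ 2) * manifoldFisherInformation M P p) ∧
    ((∀ x ∈ M, ∀ v : tangentSpaceAt M x, ‖tangentialJacobian M E x v‖ = ‖v‖) →
      IsSmoothSubmanifold m (E '' M) ∧
      (∃ q, IsSmoothPosDensity m (E '' M) (P.map E) q) ∧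
      ∀ q, IsSmoothPosDensity m (E '' M) (P.map E) q →
        manifoldFisherInformation (E '' M) (P.map E) q = manifoldFisherInformation M P p) := by
  -- The lower bound alone makes `E` an immersion.
  have hinj : ∀ {c : ℝ}, 0 < c → (∀ x ∈ M, ∀ v : tangentSpaceAt M x,
      c * ‖v‖ ≤ ‖tangentialJacobian M E x v‖) → IsSmoothEmbeddingOn m M E := fun hc h =>
    ⟨hM, hE, hEmb, fun x hx => (injective_iff_map_eq_zero _).2 fun v hv => by
      have := h x hx v
      rw [hv, norm_zero] at this
      exact norm_le_zero_iff.1 (nonpos_of_mul_nonpos_right this hc)⟩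
  have hmain : ∀ c C : ℝ, 0 < c → 0 < C →
      (∀ x ∈ M, ∀ v : tangentSpaceAt M x,
        c * ‖v‖ ≤ ‖tangentialJacobian M E x v‖ ∧ ‖tangentialJacobian M E x v‖ ≤ C * ‖v‖) →
      (∀ x ∈ M, manifoldGradient M (fun y => Real.log (volumeElement M E y)) x = 0) →
      IsSmoothSubmanifold m (E '' M) ∧
      (∃ q, IsSmoothPosDensity m (E '' M) (P.map E) q) ∧
      ∀ q, IsSmoothPosDensity m (E '' M) (P.map E) q →
        ENNReal.ofReal (1 / C ^ 2) * manifoldFisherInformation M P p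
            ≤ manifoldFisherInformation (E '' M) (P.map E) q ∧
        manifoldFisherInformation (E '' M) (P.map E) q
            ≤ ENNReal.ofReal (1 / c ^ 2) * manifoldFisherInformation M P p := by
    intro c C hc hC hbd hvol
    have h := hinj hc fun x hx v => (hbd x hx v).1
    obtain ⟨q, hq, -⟩ := h.exists_isSmoothPosDensity hp
    exact ⟨h.isSmoothSubmanifold_image, ⟨q, hq⟩,
      fun q hq => h.manifoldFisherInformation_bounds hp hq hc hC hbd hvol⟩
  refine ⟨hmain, fun hiso => ?_⟩
  obtain ⟨h1, h2, h3⟩ := hmain 1 1 one_pos one_pos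
    (fun x hx v => by rw [hiso x hx v, one_mul]; exact ⟨le_rfl, le_rfl⟩)
    (fun x hx => manifoldGradient_eq_zero_of_eqOn_const (a := 0)
      (fun y hy => by rw [volumeElement_eq_one_of_isometry (hiso y hy), Real.log_one]) hx)
  refine ⟨h1, h2, fun q hq => ?_⟩
  obtain ⟨h4, h5⟩ := h3 q hq
  simp only [one_pow, div_one, ENNReal.ofReal_one, one_mul] at h4 h5
  exact le_antisymm h5 h4
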